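/- Let $K\ge 1$, let $\mathcal S\subset\mathbb R^q$ be any subset with its Borel $\sigma$-algebra, and consider $K$-state hidden Markov models $(X_t,Y_t)_{t\ge 1}$ with observations in $\mathcal S$: $(X_t)$ is a time-homogeneous Markov chain on $\{1,\dots,K\}$ and, given $(X_t)$, the $Y_t$ are independent, the conditional distribution of $Y_t$ depending only on $X_t$ and being $F_k$ when $X_t=k$. A parameter set consists of a starting probability vector, a stochastic $K\times K$ transition matrix and $K$ probability distributions on $\mathcal S$ (the state-dependent distributions). Let $(\pi,\Gamma,F_1,\dots,F_K)$ and $(\lambda,\tilde\Gamma,\tilde F_1,\dots,\tilde F_K)$ be two parameter sets under which the joint distributions of $(Y_1,\dots,Y_{2K+1})$ are equal. Suppose that $\Gamma$ has full rank and is ergodic (irreducible and aperiodic), that $F_1,\dots,F_K$ are pairwise distinct, and that the first chain is stationary, i.e. $\pi\Gamma=\pi$. Nothing further is assumed about the second parameter set; in particular its starting distribution $\lambda$ is arbitrary. Then the two parameter sets coincide up to label swapping: there is a permutation $\sigma$ of $\{1,\dots,K\}$ such that $$\tilde\alpha_{\sigma(j),\sigma(k)}=\alpha_{j,k},\qquad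 \tilde F_{\sigma(k)}=F_k,\qquad \lambda_{\sigma(k)}=\pi_k\qquad (j,k=1,\dots,K),$$ where $\Gamma=(\alpha_{j,k})$ and $\tilde\Gamma=(\tilde\alpha_{j,k})$. -/

import Mathlib

open MeasureTheory
open scoped Matrix

/-- A parameter set of a (time-homogeneous) `K`-state hidden Markov model with observations in `S`:
a starting probability vector, a stochastic transition matrix, and the state-dependent
distributions (one probability measure on `S` per state). -/
structure HMMParam (K : ℕ) (S : Type*) [MeasurableSpace S] where
  /-- the starting distribution -/
  init : Fin K → ℝ
  /-- the transition probability matrix -/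
  trans : Matrix (Fin K) (Fin K) ℝ
  /-- the state-dependent distributions -/
  emis : Fin K → ProbabilityMeasure S
  init_mem : init ∈ stdSimplex ℝ (Fin K)
  trans_mem : trans ∈ Matrix.rowStochastic ℝ (Fin K)

/-- `(X_t, Y_t)` on the probability space `(Ω, P)` is a hidden Markov model with parameters `θ`.
Time starts at index `0`, so `X 0, Y 0` are the first state and the first observation. -/
structure IsHMM {K : ℕ} {S : Type*} [MeasurableSpace S] (θ : HMMParam K S)
    {Ω : Type*} [MeasurableSpace Ω] (P : Measure Ω) (X : ℕ → Ω → Fin K) (Y : ℕ → Ω → S) : Prop where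
  measurable_state : ∀ t, Measurable (X t)
  measurable_obs : ∀ t, Measurable (Y t)
  /-- the starting distribution of the chain -/
  map_zero : ∀ k, P.real {ω | X 0 ω = k} = θ.init k
  /-- the Markov property with homogeneous transition matrix, without division by zero -/
  markov : ∀ (n : ℕ) (x : ℕ → Fin K),
    P.real {ω | ∀ t ≤ n + 1, X t ω = x t} =
      P.real {ω | ∀ t ≤ n, X t ω = x t} * θ.trans (x n) (x (n + 1))
  /-- given the states, the observations are independent, and the conditional distribution of
  `Y t` is the state-dependent distribution of the state at time `t` -/
  emission : ∀ (n : ℕ) (x : ℕ → Fin K) (B : ℕ → Set S), (∀ t, MeasurableSet (B t)) →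
    P.real {ω | (∀ t ≤ n, X t ω = x t) ∧ ∀ t ≤ n, Y t ω ∈ B t} =
      P.real {ω | ∀ t ≤ n, X t ω = x t} *
        ∏ t ∈ Finset.range (n + 1), (θ.emis (x t) : Measure S).real (B t)

/-- A transition matrix is aperiodic if every state has period one, i.e. `1` is the only common
divisor of the possible return times. -/
def Matrix.IsAperiodic {K : ℕ} (A : Matrix (Fin K) (Fin K) ℝ) : Prop :=
  ∀ (i : Fin K) (d : ℕ), (∀ n : ℕ, 0 < n → 0 < (A ^ n) i i → d ∣ n) → d = 1

/-- A finite-state transition matrix is ergodic if it is irreducible and aperiodic. -/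
def Matrix.IsErgodic {K : ℕ} (A : Matrix (Fin K) (Fin K) ℝ) : Prop :=
  A.IsIrreducible ∧ A.IsAperiodic

/-! The weight of a word of observation sets is a product `π M(B₁) ⋯ M(Bₙ) 1` with
`M(B) = diag(F(B)) Γ`, so a hidden Markov model is a weighted automaton, and weighted automata that
are reachable and observable are determined by their weights up to a change of basis `T`.
Reachability and observability hold here because a subspace stable under both `Γ` and all
`diag(F(B)) Γ` is stable under all `diag(F(B))`, hence spanned by coordinate vectors. Words of
length less than `K` suffice to span the state space from either side, and one more letter in the
middle yields `T M(B) = M'(B) T`; this uses words of length at most `2K - 1`. Finally, `T`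
intertwines the diagonal matrices `diag(F(B))` and `diag(F'(B))`, which forces each row of `T` to
have a single nonzero entry, and preserves the vector `1`, so `T` is a permutation matrix. -/

section CyclicVectors

open Module

variable {ι R M : Type*} [Semiring R] [AddCommMonoid M] [Module R M]

/-- The vector `v` is cyclic for the operators `A i` if it lies in no proper common invariant
submodule. -/
def IsCyclicVector (A : ι → End R M) (v : M) : Prop :=
  ∀ W : Submodule R M, v ∈ W → (∀ i, W ∈ (A i).invtSubmodule) → W = ⊤

/-- The span of the images of `v` under the words of length less than `n` in the operators `A i`
(a Krylov space). The word `[i₁, …, iₘ]` acts as `A i₁ * ⋯ * A iₘ`. -/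
def wordSpan (A : ι → End R M) (v : M) (n : ℕ) : Submodule R M :=
  Submodule.span R ((fun L : List ι ↦ (L.map A).prod v) '' {L | L.length < n})

variable {A : ι → End R M} {v : M}

theorem list_prod_apply_mem_wordSpan {L : List ι} {n : ℕ} (hL : L.length < n) :
    (L.map A).prod v ∈ wordSpan A v n :=
  Submodule.subset_span ⟨L, hL, rfl⟩

theorem wordSpan_le_succ (n : ℕ) : wordSpan A v n ≤ wordSpan A v (n + 1) :=
  Submodule.span_mono <| Set.image_mono fun _ hL ↦ Nat.lt_succ_of_lt hL

theorem wordSpan_le_comap_succ (i : ι) (n : ℕ) :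
    wordSpan A v n ≤ (wordSpan A v (n + 1)).comap (A i) := by
  rw [wordSpan, Submodule.span_le]
  rintro _ ⟨L, hL, rfl⟩
  simpa using list_prod_apply_mem_wordSpan (A := A) (v := v) (L := i :: L) (Nat.succ_lt_succ hL)

theorem IsCyclicVector.wordSpan_eq_top_of_eq_succ (h : IsCyclicVector A v) {n : ℕ}
    (hn : wordSpan A v n = wordSpan A v (n + 1)) : wordSpan A v n = ⊤ := by
  refine h _ ?_ fun i ↦ (wordSpan_le_comap_succ i n).trans_eq (by rw [← hn])
  rw [hn]
  exact list_prod_apply_mem_wordSpan (L := []) n.succ_pos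

end CyclicVectors

section FiniteDimensional

open Module

variable {ι 𝕜 V : Type*} [DivisionRing 𝕜] [AddCommGroup V] [Module 𝕜 V]
  [FiniteDimensional 𝕜 V] {A : ι → End 𝕜 V} {v : V}

theorem IsCyclicVector.le_finrank_wordSpan_or_eq_top (h : IsCyclicVector A v) (n : ℕ) :
    n ≤ finrank 𝕜 (wordSpan A v n) ∨ wordSpan A v n = ⊤ := by
  induction n with
  | zero => exact .inl (Nat.zero_le _)
  | succ n ih =>
    rcases (wordSpan_le_succ (A := A) (v := v) n).eq_or_lt with heq | hlt
    · exact .inr (heq ▸ h.wordSpan_eq_top_of_eq_succ heq)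
    · exact .inl <| (ih.resolve_right hlt.ne_top).trans_lt (Submodule.finrank_lt_finrank_of_lt hlt)

theorem IsCyclicVector.wordSpan_finrank_eq_top (h : IsCyclicVector A v) :
    wordSpan A v (finrank 𝕜 V) = ⊤ :=
  (h.le_finrank_wordSpan_or_eq_top _).elim
    (fun hn ↦ Submodule.eq_top_of_finrank_eq (hn.antisymm' (Submodule.finrank_le _))) id

theorem IsCyclicVector.exists_linearIndependent_words (h : IsCyclicVector A v) :
    ∃ a : Fin (finrank 𝕜 V) → List ι, (∀ i, (a i).length < finrank 𝕜 V) ∧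
      LinearIndependent 𝕜 fun i ↦ ((a i).map A).prod v := by
  have hspan := h.wordSpan_finrank_eq_top
  obtain ⟨f, hf, -, hli⟩ := Submodule.exists_fun_fin_finrank_span_eq 𝕜
    ((fun L : List ι ↦ (L.map A).prod v) '' {L | L.length < finrank 𝕜 V})
  choose a ha hfa using hf
  obtain rfl : (fun i ↦ ((a i).map A).prod v) = f := funext hfa
  have hcard : finrank 𝕜 V = finrank 𝕜 (wordSpan A v (finrank 𝕜 V)) := by rw [hspan, finrank_top]
  exact ⟨fun i ↦ a (Fin.cast hcard i), fun _ ↦ ha _, hli.comp _ (Fin.cast_injective hcard)⟩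

theorem map_eq_self_of_mem_invtSubmodule {f : End 𝕜 V}
    (hf : Function.Injective f) {W : Submodule 𝕜 V} (hW : W ∈ f.invtSubmodule) : W.map f = W :=
  Submodule.eq_of_le_of_finrank_eq (Submodule.map_le_iff_le_comap.2 hW)
    (Submodule.equivMapOfInjective f hf W).finrank_eq.symm

theorem mem_invtSubmodule_of_mul_left {f g : End 𝕜 V}
    (hf : Function.Injective f) {W : Submodule 𝕜 V} (hWf : W ∈ f.invtSubmodule)
    (hWfg : W ∈ (f * g).invtSubmodule) : W ∈ g.invtSubmodule := by
  intro w hw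
  have hfgw : f (g w) ∈ W.map f := (map_eq_self_of_mem_invtSubmodule hf hWf).symm ▸ hWfg hw
  obtain ⟨u, hu, hfu⟩ := hfgw
  rwa [Submodule.mem_comap, ← hf hfu]

theorem mem_invtSubmodule_of_mul_right {f g : End 𝕜 V}
    (hf : Function.Injective f) {W : Submodule 𝕜 V} (hWf : W ∈ f.invtSubmodule)
    (hWgf : W ∈ (g * f).invtSubmodule) : W ∈ g.invtSubmodule := by
  intro w hw
  rw [← map_eq_self_of_mem_invtSubmodule hf hWf] at hw
  obtain ⟨u, hu, rfl⟩ := hw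
  exact hWgf hu

end FiniteDimensional

section CoordinateSubspaces

variable {ι κ 𝕜 : Type*} [DivisionRing 𝕜] {g : ι → κ → 𝕜} {W : Submodule 𝕜 (κ → 𝕜)}

theorem exists_mem_apply_ne_zero_and_eq_zero_on (hg : Function.Injective fun k i ↦ g i k)
    (hW : ∀ i, ∀ w ∈ W, g i * w ∈ W) {k : κ} (hk : ∃ w ∈ W, w k ≠ 0) (s : Finset κ) (hks : k ∉ s) :
    ∃ w ∈ W, w k ≠ 0 ∧ ∀ l ∈ s, w l = 0 := by
  classical
  induction s using Finset.induction_on with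
  | empty => simpa using hk
  | insert l s _ ih =>
    obtain ⟨w, hwW, hwk, hws⟩ := ih fun hk ↦ hks (Finset.mem_insert_of_mem hk)
    have hkl : k ≠ l := fun hkl ↦ hks (hkl ▸ Finset.mem_insert_self l s)
    obtain ⟨i, hi⟩ : ∃ i, g i k ≠ g i l := Function.ne_iff.1 (hg.ne hkl)
    have hvalue (m : κ) : (g i * w - g i l • w) m = (g i m - g i l) * w m := by
      simp [sub_mul]
    refine ⟨g i * w - g i l • w, W.sub_mem (hW i w hwW) (W.smul_mem _ hwW), ?_, ?_⟩
    · rw [hvalue]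
      exact mul_ne_zero (sub_ne_zero.2 hi) hwk
    · intro m hm
      rw [hvalue]
      rcases Finset.mem_insert.1 hm with rfl | hm
      · rw [sub_self, zero_mul]
      · rw [hws m hm, mul_zero]

theorem single_mem_of_forall_mul_mem [Finite κ] [DecidableEq κ]
    (hg : Function.Injective fun k i ↦ g i k) (hW : ∀ i, ∀ w ∈ W, g i * w ∈ W) {k : κ}
    (hk : ∃ w ∈ W, w k ≠ 0) : Pi.single k 1 ∈ W := by
  have := Fintype.ofFinite κ
  obtain ⟨w, hwW, hwk, hw⟩ :=
    exists_mem_apply_ne_zero_and_eq_zero_on hg hW hk (Finset.univ.erase k) (by simp)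
  have hsingle : (Pi.single k 1 : κ → 𝕜) = (w k)⁻¹ • w := by
    ext l
    rcases eq_or_ne l k with rfl | hlk
    · simp [hwk]
    · simp [hlk, hw l (by simpa using hlk)]
  exact hsingle ▸ W.smul_mem _ hwW

theorem eq_top_of_forall_mul_mem [Finite κ] (hg : Function.Injective fun k i ↦ g i k)
    (hW : ∀ i, ∀ w ∈ W, g i * w ∈ W) (hne : ∀ k, ∃ w ∈ W, w k ≠ 0) : W = ⊤ := by
  classical
  rw [eq_top_iff, ← (Pi.basisFun 𝕜 κ).span_eq, Submodule.span_le]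
  rintro _ ⟨k, rfl⟩
  simpa using single_mem_of_forall_mul_mem hg hW (hne k)

end CoordinateSubspaces

section WeightedAutomata

open Matrix

variable {ι κ R : Type*} [CommSemiring R] [Fintype κ] [DecidableEq κ]

/-- The weight of the word `L` in the weighted automaton with initial vector `p`, transition
matrices `A i` and final vector `q`. -/
def wordWeight (p : κ → R) (A : ι → Matrix κ κ R) (q : κ → R) (L : List ι) : R :=
  p ⬝ᵥ (L.map A).prod *ᵥ q

variable {p p' q q' : κ → R} {A A' : ι → Matrix κ κ R}

theorem wordWeight_eq_vecMul_dotProduct (L : List ι) :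
    wordWeight p A q L = p ᵥ* (L.map A).prod ⬝ᵥ q :=
  dotProduct_mulVec _ _ _

theorem wordWeight_append (L M : List ι) :
    wordWeight p A q (L ++ M) = p ᵥ* (L.map A).prod ⬝ᵥ (M.map A).prod *ᵥ q := by
  rw [wordWeight, List.map_append, List.prod_append, ← mulVec_mulVec, dotProduct_mulVec]

theorem wordWeight_append_cons (L M : List ι) (i : ι) :
    wordWeight p A q (L ++ i :: M) = p ᵥ* (L.map A).prod ⬝ᵥ A i *ᵥ (M.map A).prod *ᵥ q := by
  rw [wordWeight_append, List.map_cons, List.prod_cons, ← mulVec_mulVec]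

theorem list_prod_mulVecLin_apply (L : List ι) (v : κ → R) :
    (L.map fun i ↦ ((A i).mulVecLin : Module.End R (κ → R))).prod v = (L.map A).prod *ᵥ v := by
  induction L with
  | nil => simp
  | cons i L ih => simp [ih]

theorem list_prod_vecMulLinear_apply (L : List ι) (v : κ → R) :
    (L.map fun i ↦ ((A i).vecMulLinear : Module.End R (κ → R))).prod v =
      v ᵥ* (L.reverse.map A).prod := by
  induction L with
  | nil => simp
  | cons i L ih => simp [ih]

theorem exists_intertwiner_of_mul_eq_mul {U U' S S' : Matrix κ κ R} (hU : IsUnit U)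
    (hS : IsUnit S) (hUS : U * S = U' * S') (hUAS : ∀ i, U * A i * S = U' * A' i * S')
    (hUq : U *ᵥ q = U' *ᵥ q') (hpS : p ᵥ* S = p' ᵥ* S') :
    ∃ T : Matrix κ κ R, IsUnit T ∧ p' ᵥ* T = p ∧ T *ᵥ q = q' ∧ ∀ i, T * A i = A' i * T := by
  have hU' : IsUnit U' := isUnit_of_mul_isUnit_left (hUS ▸ hU.mul hS)
  obtain ⟨V, hUV, hVU⟩ := isUnit_iff_exists.1 hU'
  have hTS : V * U * S = S' := by rw [mul_assoc, hUS, ← mul_assoc, hVU, one_mul]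
  refine ⟨V * U, (isUnit_iff_exists.2 ⟨U', hVU, hUV⟩).mul hU, ?_, ?_, fun i ↦ ?_⟩
  · refine vecMul_injective_of_isUnit hS ?_
    simp only [vecMul_vecMul, hTS, hpS]
  · rw [← mulVec_mulVec, hUq, mulVec_mulVec, hVU, one_mulVec]
  · refine hS.mul_right_cancel ?_
    calc V * U * A i * S = V * (U * A i * S) := by simp only [mul_assoc]
      _ = (V * U') * A' i * S' := by rw [hUAS]; simp only [mul_assoc]
      _ = A' i * (V * U) * S := by rw [hVU, one_mul, mul_assoc (A' i), hTS]

end WeightedAutomata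

section Minimality

open Matrix

variable {ι κ 𝕜 : Type*} [Field 𝕜] [Fintype κ] [DecidableEq κ]
  {p p' q q' : κ → 𝕜} {A A' : ι → Matrix κ κ 𝕜}

theorem IsCyclicVector.exists_isUnit_mulVec_words
    (h : IsCyclicVector (fun i ↦ (A i).mulVecLin) q) :
    ∃ a : κ → List ι, (∀ j, (a j).length < Fintype.card κ) ∧
      IsUnit (of fun j ↦ ((a j).map A).prod *ᵥ q) := by
  obtain ⟨a, ha, hli⟩ := h.exists_linearIndependent_words
  let e : κ ≃ Fin (Module.finrank 𝕜 (κ → 𝕜)) :=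
    Fintype.equivFinOfCardEq (Module.finrank_fintype_fun_eq_card 𝕜).symm
  refine ⟨a ∘ e, fun j ↦ (ha _).trans_eq (Module.finrank_fintype_fun_eq_card 𝕜), ?_⟩
  simp only [list_prod_mulVecLin_apply] at hli
  exact linearIndependent_rows_iff_isUnit.1 (hli.comp e e.injective)

theorem IsCyclicVector.exists_isUnit_vecMul_words
    (h : IsCyclicVector (fun i ↦ (A i).vecMulLinear) p) :
    ∃ a : κ → List ι, (∀ j, (a j).length < Fintype.card κ) ∧
      IsUnit (of fun j ↦ p ᵥ* ((a j).map A).prod) := by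
  obtain ⟨a, ha, hli⟩ := h.exists_linearIndependent_words
  let e : κ ≃ Fin (Module.finrank 𝕜 (κ → 𝕜)) :=
    Fintype.equivFinOfCardEq (Module.finrank_fintype_fun_eq_card 𝕜).symm
  refine ⟨fun j ↦ (a (e j)).reverse, fun j ↦ ?_, ?_⟩
  · rw [List.length_reverse]
    exact (ha _).trans_eq (Module.finrank_fintype_fun_eq_card 𝕜)
  · simp only [list_prod_vecMulLinear_apply] at hli
    exact linearIndependent_rows_iff_isUnit.1 (hli.comp e e.injective)

theorem exists_intertwiner_of_wordWeight_eq
    (hp : IsCyclicVector (fun i ↦ (A i).vecMulLinear) p)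
    (hq : IsCyclicVector (fun i ↦ (A i).mulVecLin) q)
    (hweight : ∀ L : List ι, L.length < 2 * Fintype.card κ →
      wordWeight p A q L = wordWeight p' A' q' L) :
    ∃ T : Matrix κ κ 𝕜, IsUnit T ∧ p' ᵥ* T = p ∧ T *ᵥ q = q' ∧ ∀ i, T * A i = A' i * T := by
  obtain ⟨a, ha, hU⟩ := hp.exists_isUnit_vecMul_words
  obtain ⟨b, hb, hS⟩ := hq.exists_isUnit_mulVec_words
  refine exists_intertwiner_of_mul_eq_mul hU ((isUnit_transpose _).2 hS)
    (U' := of fun j ↦ p' ᵥ* ((a j).map A').prod)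
    (S' := (of fun j ↦ ((b j).map A').prod *ᵥ q')ᵀ) ?_ (fun i ↦ ?_) ?_ ?_
  · ext j k
    have hword := hweight (a j ++ b k) (by grind)
    rwa [wordWeight_append, wordWeight_append] at hword
  · ext j k
    have hword := hweight (a j ++ i :: b k) (by grind)
    rw [wordWeight_append_cons, wordWeight_append_cons] at hword
    rwa [mul_assoc, mul_assoc]
  · ext j
    have hword := hweight (a j) (by grind)
    rwa [wordWeight_eq_vecMul_dotProduct, wordWeight_eq_vecMul_dotProduct] at hword
  · ext k
    exact hweight (b k) (by grind)

end Minimality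

section Matrices

open Matrix

theorem isUnit_of_rank_eq_card {κ 𝕜 : Type*} [Field 𝕜] [Fintype κ] [DecidableEq κ]
    {A : Matrix κ κ 𝕜} (h : A.rank = Fintype.card κ) : IsUnit A := by
  have hrange : LinearMap.range A.mulVecLin = ⊤ :=
    Submodule.eq_top_of_finrank_eq (h.trans (Module.finrank_fintype_fun_eq_card 𝕜).symm)
  exact mulVec_surjective_iff_isUnit.1 (LinearMap.range_eq_top.1 hrange)

theorem exists_vecMul_pow_apply_pos_of_isIrreducible {κ R : Type*} [Fintype κ] [DecidableEq κ]
    [Ring R] [LinearOrder R] [IsStrictOrderedRing R] {A : Matrix κ κ R} (hA : A.IsIrreducible)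
    {p : κ → R} (hp : 0 < p) (k : κ) : ∃ n, 0 < (p ᵥ* A ^ n) k := by
  obtain ⟨hp₀, j, hj⟩ := Pi.lt_def.1 hp
  obtain ⟨n, -, hn⟩ := (isIrreducible_iff_exists_pow_pos hA.nonneg).1 hA j k
  exact ⟨n, Finset.sum_pos' (fun i _ ↦ mul_nonneg (hp₀ i) (pow_apply_nonneg hA.nonneg n i k))
    ⟨j, Finset.mem_univ j, mul_pos hj hn⟩⟩

theorem exists_eq_permMatrix {κ R : Type*} [Fintype κ] [DecidableEq κ] [CommRing R] [Nontrivial R]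
    {T : Matrix κ κ R} (hT : IsUnit T) (hT₁ : T *ᵥ 1 = 1)
    (hrow : ∀ i j k, T i j ≠ 0 → T i k ≠ 0 → j = k) :
    ∃ σ : Equiv.Perm κ, T = σ.permMatrix R := by
  have hsum (i : κ) : ∑ j, T i j = 1 := by simpa [mulVec, dotProduct] using congrFun hT₁ i
  have hne (i : κ) : ∃ j, T i j ≠ 0 := by
    by_contra! hzero
    simpa [hzero] using hsum i
  choose τ hτ using hne
  have hrow_eq (i : κ) : T i = Pi.single (τ i) 1 := by
    have hzero (j : κ) (hj : j ≠ τ i) : T i j = 0 := by_contra fun h ↦ hj (hrow i j _ h (hτ i))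
    have hone : T i (τ i) = 1 := by
      rw [← hsum i, Fintype.sum_eq_single _ hzero]
    ext j
    rcases eq_or_ne j (τ i) with rfl | hj
    · rw [hone, Pi.single_eq_same]
    · rw [hzero j hj, Pi.single_eq_of_ne hj]
  have hinj : Function.Injective τ := by
    intro i j hij
    by_contra hne
    refine not_isUnit_zero (M₀ := R) ?_
    rw [← det_zero_of_row_eq hne (show T i = T j by rw [hrow_eq, hrow_eq, hij])]
    exact (isUnit_iff_isUnit_det T).1 hT
  refine ⟨Equiv.ofBijective τ (Finite.injective_iff_bijective.1 hinj), ?_⟩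
  ext i j
  rw [congrFun (hrow_eq i) j]
  simp [PEquiv.toMatrix_apply, Pi.single_apply, eq_comm]

variable {ι κ 𝕜 : Type*} [Field 𝕜] [Fintype κ] [DecidableEq κ] {b : ι → κ → 𝕜} {Γ : Matrix κ κ 𝕜}

theorem isCyclicVector_vecMulLinear_diagonal_mul (hb : Function.Injective fun k i ↦ b i k)
    (hb₁ : ∃ i, b i = 1) (hΓ : IsUnit Γ) {p : κ → 𝕜} (hp : ∀ k, ∃ n, (p ᵥ* Γ ^ n) k ≠ 0) :
    IsCyclicVector (fun i ↦ (diagonal (b i) * Γ).vecMulLinear) p := by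
  intro W hpW hW
  have hWΓ : W ∈ Module.End.invtSubmodule Γ.vecMulLinear := by
    obtain ⟨i, hi⟩ := hb₁
    simpa [hi] using hW i
  have hpow (n : ℕ) : p ᵥ* Γ ^ n ∈ W := by
    induction n with
    | zero => simpa using hpW
    | succ n ih =>
      rw [pow_succ, ← vecMul_vecMul]
      exact hWΓ ih
  refine eq_top_of_forall_mul_mem hb (fun i w hw ↦ ?_) fun k ↦
    (hp k).imp' (p ᵥ* Γ ^ ·) fun n hn ↦ ⟨hpow n, hn⟩
  have hmul : (diagonal (b i) * Γ).vecMulLinear =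
      (Γ.vecMulLinear * (diagonal (b i)).vecMulLinear : Module.End 𝕜 (κ → 𝕜)) := by
    ext; simp
  have hWi : W ∈ Module.End.invtSubmodule (diagonal (b i) * Γ).vecMulLinear := hW i
  rw [hmul] at hWi
  have hmem : w ᵥ* diagonal (b i) ∈ W :=
    mem_invtSubmodule_of_mul_left (vecMul_injective_iff_isUnit.2 hΓ) hWΓ hWi hw
  have hdiag : w ᵥ* diagonal (b i) = b i * w := by
    ext k
    rw [vecMul_diagonal, mul_comm, Pi.mul_apply]
  exact hdiag ▸ hmem

theorem isCyclicVector_mulVecLin_diagonal_mul (hb : Function.Injective fun k i ↦ b i k)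
    (hb₁ : ∃ i, b i = 1) (hΓ : IsUnit Γ) {q : κ → 𝕜} (hq : ∀ k, q k ≠ 0) :
    IsCyclicVector (fun i ↦ (diagonal (b i) * Γ).mulVecLin) q := by
  intro W hqW hW
  have hWΓ : W ∈ Module.End.invtSubmodule Γ.mulVecLin := by
    obtain ⟨i, hi⟩ := hb₁
    simpa [hi] using hW i
  refine eq_top_of_forall_mul_mem hb (fun i w hw ↦ ?_) fun k ↦ ⟨q, hqW, hq k⟩
  have hWi : W ∈ Module.End.invtSubmodule (diagonal (b i) * Γ).mulVecLin := hW i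
  rw [mulVecLin_mul] at hWi
  have hmem : diagonal (b i) *ᵥ w ∈ W :=
    mem_invtSubmodule_of_mul_right (mulVec_injective_iff_isUnit.2 hΓ) hWΓ hWi hw
  have hdiag : diagonal (b i) *ᵥ w = b i * w := funext (mulVec_diagonal (b i) w)
  exact hdiag ▸ hmem

end Matrices

/-- The measurable subsets of `S`, the letters of the words that encode finite-dimensional events of
the observation process. -/
abbrev MeasurableSets (S : Type*) [MeasurableSpace S] : Type _ :=
  Subtype (MeasurableSet : Set S → Prop)

namespace HMMParam

variable {K : ℕ} {S : Type*} [MeasurableSpace S] (θ : HMMParam K S)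

/-- The probabilities of `B` under the state-dependent distributions. -/
noncomputable def emissionProb (B : MeasurableSets S) (k : Fin K) : ℝ :=
  (θ.emis k : Measure S).real B

/-- The matrix whose `(j, k)` entry is the probability of observing a value in `B` in state `j` and
then moving to state `k`. -/
noncomputable def obsMatrix (B : MeasurableSets S) : Matrix (Fin K) (Fin K) ℝ :=
  Matrix.diagonal (θ.emissionProb B) * θ.trans

/-- The probability that the first observations lie in the successive sets of the word `L`. -/
noncomputable def wordProb (L : List (MeasurableSets S)) : ℝ :=
  wordWeight θ.init θ.obsMatrix 1 L

theorem init_pos : 0 < θ.init :=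
  lt_of_le_of_ne θ.init_mem.1 fun h ↦ by simpa [← h] using θ.init_mem.2

theorem emissionProb_top : θ.emissionProb ⊤ = 1 := by
  ext k
  simp [emissionProb]

theorem obsMatrix_top : θ.obsMatrix ⊤ = θ.trans := by
  rw [obsMatrix, emissionProb_top, Pi.one_def, Matrix.diagonal_one, one_mul]

theorem obsMatrix_mulVec_apply (B : MeasurableSets S) (v : Fin K → ℝ) (j : Fin K) :
    (θ.obsMatrix B *ᵥ v) j = ∑ k, θ.emissionProb B j * θ.trans j k * v k := by
  simp [obsMatrix, Matrix.mulVec, dotProduct]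

variable {θ} {θ' : HMMParam K S}

theorem emis_eq_emis_iff {j k : Fin K} :
    θ'.emis j = θ.emis k ↔ ∀ B, θ'.emissionProb B j = θ.emissionProb B k := by
  refine ⟨fun h B ↦ by rw [emissionProb, h, emissionProb], fun h ↦ ?_⟩
  refine Subtype.ext (Measure.ext fun B hB ↦ ?_)
  exact (measureReal_eq_measureReal_iff (measure_ne_top (θ'.emis j : Measure S) B)
    (measure_ne_top (θ.emis k : Measure S) B)).1 (h ⟨B, hB⟩)

theorem injective_emissionProb (h : Function.Injective θ.emis) :
    Function.Injective fun k B ↦ θ.emissionProb B k :=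
  fun _ _ hjk ↦ h (emis_eq_emis_iff.2 (congrFun hjk))

theorem exists_intertwiner_of_wordProb_eq (htrans : IsUnit θ.trans)
    (hvisit : ∀ k, ∃ n, (θ.init ᵥ* θ.trans ^ n) k ≠ 0) (hemis : Function.Injective θ.emis)
    (hword : ∀ L, L.length < 2 * K → θ.wordProb L = θ'.wordProb L) :
    ∃ T : Matrix (Fin K) (Fin K) ℝ, IsUnit T ∧ θ'.init ᵥ* T = θ.init ∧ T *ᵥ 1 = 1 ∧
      ∀ B, T * θ.obsMatrix B = θ'.obsMatrix B * T := by
  have hb := injective_emissionProb hemis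
  have hb₁ : ∃ B, θ.emissionProb B = 1 := ⟨⊤, θ.emissionProb_top⟩
  exact exists_intertwiner_of_wordWeight_eq
    (isCyclicVector_vecMulLinear_diagonal_mul hb hb₁ htrans hvisit)
    (isCyclicVector_mulVecLin_diagonal_mul hb hb₁ htrans fun _ ↦ one_ne_zero)
    (by simpa [wordProb] using hword)

theorem emis_eq_of_intertwiner (htrans : IsUnit θ.trans) {T : Matrix (Fin K) (Fin K) ℝ}
    (hT : ∀ B, T * θ.obsMatrix B = θ'.obsMatrix B * T) {i j : Fin K} (hij : T i j ≠ 0) :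
    θ'.emis i = θ.emis j := by
  have hTtrans : T * θ.trans = θ'.trans * T := by simpa only [obsMatrix_top] using hT ⊤
  refine emis_eq_emis_iff.2 fun B ↦ ?_
  have hdiag : T * .diagonal (θ.emissionProb B) = .diagonal (θ'.emissionProb B) * T := by
    refine htrans.mul_right_cancel ?_
    rw [mul_assoc, mul_assoc, hTtrans, ← mul_assoc (Matrix.diagonal _)]
    exact hT B
  have hentry := congrFun₂ hdiag i j
  rw [Matrix.mul_diagonal, Matrix.diagonal_mul, mul_comm] at hentry
  exact (mul_right_cancel₀ hij hentry).symm

theorem exists_perm_of_wordProb_eq (htrans : IsUnit θ.trans)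
    (hvisit : ∀ k, ∃ n, (θ.init ᵥ* θ.trans ^ n) k ≠ 0) (hemis : Function.Injective θ.emis)
    (hword : ∀ L, L.length < 2 * K → θ.wordProb L = θ'.wordProb L) :
    ∃ σ : Equiv.Perm (Fin K),
      (∀ j k, θ'.trans (σ j) (σ k) = θ.trans j k) ∧
      (∀ k, θ'.emis (σ k) = θ.emis k) ∧
      (∀ k, θ'.init (σ k) = θ.init k) := by
  obtain ⟨T, hT, hTinit, hT₁, hTobs⟩ :=
    exists_intertwiner_of_wordProb_eq htrans hvisit hemis hword
  have hTemis {i j : Fin K} (hij : T i j ≠ 0) : θ'.emis i = θ.emis j :=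
    emis_eq_of_intertwiner htrans hTobs hij
  obtain ⟨τ, rfl⟩ := exists_eq_permMatrix hT hT₁ fun i j k hij hik ↦
    hemis ((hTemis hij).symm.trans (hTemis hik))
  have hTtrans := hTobs ⊤
  rw [obsMatrix_top, obsMatrix_top, PEquiv.toMatrix_toPEquiv_mul,
    PEquiv.mul_toMatrix_toPEquiv] at hTtrans
  rw [PEquiv.vecMul_toMatrix_toPEquiv] at hTinit
  refine ⟨τ.symm, fun j k ↦ ?_, fun k ↦ hTemis ?_, congrFun hTinit⟩
  · simpa using (congrFun₂ hTtrans (τ.symm j) k).symm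
  · simp

end HMMParam

theorem measureReal_eq_sum_fiber {Ω α : Type*} [MeasurableSpace Ω] [Fintype α] [MeasurableSpace α]
    [MeasurableSingletonClass α] (P : Measure Ω) [IsFiniteMeasure P] {X : Ω → α}
    (hX : Measurable X) (E : Set Ω) : P.real E = ∑ k, P.real {ω | X ω = k ∧ ω ∈ E} := by
  have hfiber (k : α) : MeasurableSet (X ⁻¹' {k}) := hX (measurableSet_singleton k)
  have hsum := sum_measureReal_preimage_singleton (μ := P.restrict E) Finset.univ
    fun k _ ↦ hfiber k
  simp only [measureReal_restrict_apply (hfiber _)] at hsum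
  have hpreimage : P.real E = ∑ k, P.real (X ⁻¹' {k} ∩ E) := by simpa using hsum.symm
  exact hpreimage

namespace IsHMM

variable {K : ℕ} {S : Type*} [MeasurableSpace S] {θ θ' : HMMParam K S} {Ω Ω' : Type*}
  [MeasurableSpace Ω] [MeasurableSpace Ω'] {P : Measure Ω} {P' : Measure Ω'}
  {X : ℕ → Ω → Fin K} {Y : ℕ → Ω → S} {X' : ℕ → Ω' → Fin K} {Y' : ℕ → Ω' → S}

theorem measureReal_path_inter_obs_lt (h : IsHMM θ P X Y) (B : ℕ → MeasurableSets S) (n : ℕ)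
    (x : ℕ → Fin K) :
    P.real {ω | (∀ t ≤ n, X t ω = x t) ∧ ∀ t < n, Y t ω ∈ (B t : Set S)} =
      P.real {ω | ∀ t ≤ n, X t ω = x t} *
        ∏ t ∈ Finset.range n, θ.emissionProb (B t) (x t) := by
  have hemission := h.emission n x (fun t ↦ if t < n then B t else Set.univ) fun t ↦ by
    split_ifs
    exacts [(B t).2, .univ]
  rw [Finset.prod_range_succ, if_neg (lt_irrefl n), probReal_univ, mul_one] at hemission
  convert hemission using 2
  · congr! 4 with ω
    grind
  · exact Finset.prod_congr rfl fun t ht ↦ by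
      rw [if_pos (Finset.mem_range.1 ht), HMMParam.emissionProb]

theorem measureReal_path_inter_obs_lt_succ (h : IsHMM θ P X Y) (B : ℕ → MeasurableSets S) (n : ℕ)
    (x : ℕ → Fin K) :
    P.real {ω | (∀ t ≤ n + 1, X t ω = x t) ∧ ∀ t < n + 1, Y t ω ∈ (B t : Set S)} =
      P.real {ω | (∀ t ≤ n, X t ω = x t) ∧ ∀ t < n, Y t ω ∈ (B t : Set S)} *
        (θ.emissionProb (B n) (x n) * θ.trans (x n) (x (n + 1))) := by
  rw [h.measureReal_path_inter_obs_lt, h.measureReal_path_inter_obs_lt, h.markov,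
    Finset.prod_range_succ]
  ring

theorem measureReal_path_inter_obs_lt_add [IsFiniteMeasure P] (h : IsHMM θ P X Y)
    (B : ℕ → MeasurableSets S) (m n : ℕ) (x : ℕ → Fin K) :
    P.real {ω | (∀ t ≤ n, X t ω = x t) ∧ ∀ t < n + m, Y t ω ∈ (B t : Set S)} =
      P.real {ω | (∀ t ≤ n, X t ω = x t) ∧ ∀ t < n, Y t ω ∈ (B t : Set S)} *
        ((((List.range' n m).map B).map θ.obsMatrix).prod *ᵥ 1) (x n) := by
  induction m generalizing n x with
  | zero => simp
  | succ m ih =>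
    rw [measureReal_eq_sum_fiber P (h.measurable_state (n + 1)), List.range'_succ, List.map_cons,
      List.map_cons, List.prod_cons, ← Matrix.mulVec_mulVec, θ.obsMatrix_mulVec_apply,
      Finset.mul_sum]
    refine Finset.sum_congr rfl fun k _ ↦ ?_
    let y := Function.update x (n + 1) k
    have hy : y (n + 1) = k := Function.update_self ..
    have hyx (t : ℕ) (ht : t ≤ n) : y t = x t := Function.update_of_ne (by lia) ..
    have hpast (ω : Ω) : (∀ t ≤ n, X t ω = y t) ↔ ∀ t ≤ n, X t ω = x t :=
      forall₂_congr fun t ht ↦ by rw [hyx t ht]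
    calc P.real {ω | X (n + 1) ω = k ∧ (∀ t ≤ n, X t ω = x t) ∧
            ∀ t < n + (m + 1), Y t ω ∈ (B t : Set S)}
        = P.real {ω | (∀ t ≤ n + 1, X t ω = y t) ∧
            ∀ t < n + 1 + m, Y t ω ∈ (B t : Set S)} := by
          congr! 3 with ω
          grind
      _ = _ := by
          simp only [ih, h.measureReal_path_inter_obs_lt_succ, hpast, hy, hyx n le_rfl, mul_assoc]

theorem measureReal_obs_lt [IsFiniteMeasure P] (h : IsHMM θ P X Y) (B : ℕ → MeasurableSets S)
    (m : ℕ) :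
    P.real {ω | ∀ t < m, Y t ω ∈ (B t : Set S)} = θ.wordProb ((List.range m).map B) := by
  rw [measureReal_eq_sum_fiber P (h.measurable_state 0), List.range_eq_range', HMMParam.wordProb,
    wordWeight, dotProduct]
  refine Finset.sum_congr rfl fun k _ ↦ ?_
  have hpath := h.measureReal_path_inter_obs_lt_add B m 0 fun _ ↦ k
  simpa [h.map_zero] using hpath

theorem measurable_obs_pi (h : IsHMM θ P X Y) (n : ℕ) :
    Measurable fun ω (t : Fin n) ↦ Y t ω :=
  measurable_pi_lambda _ fun t ↦ h.measurable_obs t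

theorem wordProb_eq_measureReal_map [IsFiniteMeasure P] (h : IsHMM θ P X Y)
    (L : List (MeasurableSets S)) :
    θ.wordProb L = (P.map fun ω (t : Fin L.length) ↦ Y t ω).real
      (Set.univ.pi fun t ↦ (L[t] : Set S)) := by
  have hL : (List.range L.length).map (L.getD · ⊤) = L := by
    apply List.ext_getElem <;> simp +contextual
  rw [map_measureReal_apply (h.measurable_obs_pi _) (.univ_pi fun t ↦ L[t].2)]
  conv_lhs => rw [← hL]
  rw [← h.measureReal_obs_lt]
  congr 1
  ext ω
  simp only [Set.mem_ofPred_eq, Set.mem_preimage, Set.mem_univ_pi, Fin.forall_iff, Fin.getElem_fin]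
  exact forall₂_congr fun t ht ↦ by rw [List.getD_eq_getElem _ _ ht]

theorem map_obs_eq_of_le (h : IsHMM θ P X Y) (h' : IsHMM θ' P' X' Y') {m n : ℕ} (hmn : m ≤ n)
    (hlaw : P.map (fun ω (t : Fin n) ↦ Y t ω) = P'.map fun ω (t : Fin n) ↦ Y' t ω) :
    P.map (fun ω (t : Fin m) ↦ Y t ω) = P'.map fun ω (t : Fin m) ↦ Y' t ω := by
  have hrestrict : Measurable fun (y : Fin n → S) (t : Fin m) ↦ y (t.castLE hmn) := by fun_prop
  have hmap := congrArg (Measure.map fun (y : Fin n → S) (t : Fin m) ↦ y (t.castLE hmn)) hlaw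
  rwa [Measure.map_map hrestrict (h.measurable_obs_pi n),
    Measure.map_map hrestrict (h'.measurable_obs_pi n)] at hmap

theorem wordProb_eq_of_map_obs_eq [IsFiniteMeasure P] [IsFiniteMeasure P'] (h : IsHMM θ P X Y)
    (h' : IsHMM θ' P' X' Y') {n : ℕ}
    (hlaw : P.map (fun ω (t : Fin n) ↦ Y t ω) = P'.map fun ω (t : Fin n) ↦ Y' t ω)
    {L : List (MeasurableSets S)} (hL : L.length ≤ n) : θ.wordProb L = θ'.wordProb L := by
  rw [h.wordProb_eq_measureReal_map, h'.wordProb_eq_measureReal_map, h.map_obs_eq_of_le h' hL hlaw]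

end IsHMM

theorem mainTheorem1_general {K n : ℕ} {S : Type*} [MeasurableSpace S] (θ θ' : HMMParam K S)
    {Ω Ω' : Type*} [MeasurableSpace Ω] [MeasurableSpace Ω']
    (P : Measure Ω) [IsFiniteMeasure P] (P' : Measure Ω') [IsFiniteMeasure P']
    (X : ℕ → Ω → Fin K) (Y : ℕ → Ω → S) (X' : ℕ → Ω' → Fin K) (Y' : ℕ → Ω' → S)
    (hXY : IsHMM θ P X Y) (hXY' : IsHMM θ' P' X' Y') (htrans : IsUnit θ.trans)
    (hvisit : ∀ k, ∃ m, (θ.init ᵥ* θ.trans ^ m) k ≠ 0) (hdistinct : Function.Injective θ.emis)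
    (hn : 2 * K ≤ n + 1)
    (hlaw : P.map (fun ω (t : Fin n) ↦ Y t ω) = P'.map fun ω (t : Fin n) ↦ Y' t ω) :
    ∃ σ : Equiv.Perm (Fin K),
      (∀ j k, θ'.trans (σ j) (σ k) = θ.trans j k) ∧
      (∀ k, θ'.emis (σ k) = θ.emis k) ∧
      (∀ k, θ'.init (σ k) = θ.init k) :=
  HMMParam.exists_perm_of_wordProb_eq htrans hvisit hdistinct fun _ hL ↦
    hXY.wordProb_eq_of_map_obs_eq hXY' hlaw (by lia)

theorem mainTheorem1 {K q : ℕ} {S : Set (EuclideanSpace ℝ (Fin q))}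
    (θ θ' : HMMParam K S)
    {Ω Ω' : Type*} [MeasurableSpace Ω] [MeasurableSpace Ω']
    (P : Measure Ω) [IsProbabilityMeasure P] (P' : Measure Ω') [IsProbabilityMeasure P']
    (X : ℕ → Ω → Fin K) (Y : ℕ → Ω → S) (X' : ℕ → Ω' → Fin K) (Y' : ℕ → Ω' → S)
    (hXY : IsHMM θ P X Y) (hXY' : IsHMM θ' P' X' Y')
    (hrank : θ.trans.rank = K) (hergodic : θ.trans.IsErgodic)
    (hdistinct : Function.Injective θ.emis)
    (hstat : θ.init ᵥ* θ.trans = θ.init)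
    (hlaw : P.map (fun ω (t : Fin (2 * K + 1)) => Y t ω) =
      P'.map (fun ω (t : Fin (2 * K + 1)) => Y' t ω)) :
    ∃ σ : Equiv.Perm (Fin K),
      (∀ j k, θ'.trans (σ j) (σ k) = θ.trans j k) ∧
      (∀ k, θ'.emis (σ k) = θ.emis k) ∧
      (∀ k, θ'.init (σ k) = θ.init k) :=
  mainTheorem1_general θ θ' P P' X Y X' Y' hXY hXY' (isUnit_of_rank_eq_card (by simpa using hrank))
    (fun k ↦ (exists_vecMul_pow_apply_pos_of_isIrreducible hergodic.1 θ.init_pos k).imp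
      fun _ ↦ ne_of_gt) hdistinct (by lia) hlaw
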